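/- Let $d\in\mathbb N$ and let $\Lambda\subset\mathbb R^{2d}$ be a lattice (a discrete subgroup spanning $\mathbb R^{2d}$). For $(m,n)\in\Lambda$, $m,n\in\mathbb R^d$, let $T_{m,n}$ be the operator on $L^2(\mathbb R^d)$ given by \[ T_{m,n}g(x)=e^{2\pi i n\cdot x}\,g(x+m). \] Let $g\in L^2(\mathbb R^d)$ be such that $\{T_{m,n}g:(m,n)\in\Lambda\}$ is an exact frame for $L^2(\mathbb R^d)$, i.e. there are constants $A,B>0$ with \[ A\|f\|_2^2\le\sum_{(m,n)\in\Lambda}|\langle f,T_{m,n}g\rangle|^2\le B\|f\|_2^2\qquad\text{for all } f\in L^2(\mathbb R^d), \] and the system is no longer a frame after the removal of any one of its elements. Let $\tilde g=S^{-1}g$ be the canonical dual of $g$, where $Sf=\sum_{(m,n)\in\Lambda}\langle f,T_{m,n}g\rangle T_{m,n}g$ is the frame operator. For $v=(a,b)\in\mathbb R^d\times\mathbb R^d=\mathbb R^{2d}$ let \[ Q_v h(x)=\frac{i}{2\pi}\sum_{k=1}^d b^k\frac{\partial h}{\partial x^k}(x)+(a\cdot x)\,h(x) \] in the sense of tempered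 distributions, with $\|Q_v h\|_2=\infty$ if $Q_vh\notin L^2(\mathbb R^d)$, and let $\Omega((x,y),(\xi,\eta))=x\cdot\eta-y\cdot\xi$ be the standard symplectic form on $\mathbb R^{2d}$. Then for any $v,w\in\mathbb R^{2d}$ with $\Omega(v,w)\ne0$, \[ \|Q_v g\|_2\,\|Q_w g\|_2\,\|Q_v\tilde g\|_2\,\|Q_w\tilde g\|_2=\infty. \] -/

import Mathlib

open MeasureTheory
open scoped ENNReal SchwartzMap LineDeriv

noncomputable section

namespace BalianLow

/-! ### Frames in a Hilbert space -/

section Frames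

variable {H : Type*} [NormedAddCommGroup H] [InnerProductSpace ℂ H] {ι : Type*}

/-- The family `f` is a frame: for some bounds `0 < A`, `B`, and all `x`,
`A ‖x‖² ≤ ∑ |⟨x, f i⟩|² ≤ B ‖x‖²`. -/
def IsFrame (f : ι → H) : Prop :=
  ∃ A B : ℝ, 0 < A ∧ ∀ x : H,
    Summable (fun i => ‖inner ℂ (f i) x‖ ^ 2) ∧
    A * ‖x‖ ^ 2 ≤ ∑' i, ‖inner ℂ (f i) x‖ ^ 2 ∧
    ∑' i, ‖inner ℂ (f i) x‖ ^ 2 ≤ B * ‖x‖ ^ 2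

/-- An exact frame: a frame that stops being one after the removal of any element. -/
def IsExactFrame (f : ι → H) : Prop :=
  IsFrame f ∧ ∀ k : ι, ¬ IsFrame (fun i : {i : ι // i ≠ k} => f i)

/-- The frame operator `S x = ∑ ⟨x, f i⟩ f i` (the inner product of Mathlib is linear in its
second argument). -/
def frameOperator (f : ι → H) (x : H) : H :=
  ∑' i, inner ℂ (f i) x • f i

/-- The inverse `S⁻¹` of the frame operator, which is a bijection when `f` is a frame of a
Hilbert space. The canonical dual of `f` consists of the `S⁻¹ (f i)`. -/
def frameOperatorInv (f : ι → H) : H → H :=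
  Function.invFun (frameOperator f)

end Frames

/-! ### Time-frequency analysis on `ℝᵈ` -/

/-- `ℝᵈ` with its Euclidean structure. -/
abbrev Rd (d : ℕ) : Type := EuclideanSpace ℝ (Fin d)

/-- `L²(ℝᵈ)`, complex-valued. -/
abbrev L2 (d : ℕ) : Type := Lp ℂ 2 (volume : Measure (Rd d))

/-- The standard symplectic form `Ω((x, y), (ξ, η)) = x · η - y · ξ` on `ℝ²ᵈ = ℝᵈ × ℝᵈ`. -/
def symplecticForm {d : ℕ} (v w : Rd d × Rd d) : ℝ :=
  inner ℝ v.1 w.2 - inner ℝ v.2 w.1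

/-- The function `x ↦ e^{2πi n·x} g(x + m)`. -/
def shiftFun {d : ℕ} (p : Rd d × Rd d) (g : Rd d → ℂ) (x : Rd d) : ℂ :=
  Complex.exp (2 * Real.pi * Complex.I * (inner ℝ p.2 x : ℝ)) * g (x + p.1)

theorem memLp_shiftFun {d : ℕ} (p : Rd d × Rd d) (g : L2 d) :
    MemLp (shiftFun p g) 2 (volume : Measure (Rd d)) := by
  have h1 : MemLp (fun x => g (x + p.1)) 2 (volume : Measure (Rd d)) :=
    (Lp.memLp g).comp_measurePreserving (measurePreserving_add_right volume p.1)
  have hc : Continuous fun x : Rd d =>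
      Complex.exp (2 * Real.pi * Complex.I * (inner ℝ p.2 x : ℝ)) := by fun_prop
  refine h1.of_le (hc.aestronglyMeasurable.mul h1.1) (Filter.Eventually.of_forall fun x => ?_)
  have h2 : ‖Complex.exp (2 * Real.pi * Complex.I * (inner ℝ p.2 x : ℝ))‖ = 1 := by
    have : (2 * Real.pi * Complex.I * (inner ℝ p.2 x : ℝ) : ℂ)
        = ((2 * Real.pi * inner ℝ p.2 x : ℝ) : ℂ) * Complex.I := by
      push_cast; ring
    rw [this, Complex.norm_exp_ofReal_mul_I]
  simp only [shiftFun, norm_mul, h2, one_mul, le_refl]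

/-- The translation-modulation transformation `T_{m,n}` of `L²(ℝᵈ)`, `p = (m, n)`:
`(T_{m,n} g)(x) = e^{2πi n·x} g(x + m)`. -/
def timeFreqShift {d : ℕ} (p : Rd d × Rd d) (g : L2 d) : L2 d :=
  (memLp_shiftFun p g).toLp (shiftFun p g)

/-- The Gabor system `{T_{m,n} g : (m, n) ∈ Λ}`. -/
def gaborSystem {d : ℕ} (Λ : Submodule ℤ (Rd d × Rd d)) (g : L2 d) : Λ → L2 d :=
  fun p => timeFreqShift (p : Rd d × Rd d) g

/-- The canonical dual window `g̃ = S⁻¹ g`, `S` the frame operator of the Gabor system. -/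
def canonicalDual {d : ℕ} (Λ : Submodule ℤ (Rd d × Rd d)) (g : L2 d) : L2 d :=
  frameOperatorInv (gaborSystem Λ g) g

/-- The linear function `x ↦ a · x` on `ℝᵈ`, complex-valued. -/
def linFun {d : ℕ} (a : Rd d) (x : Rd d) : ℂ := ((inner ℝ a x : ℝ) : ℂ)

theorem hasTemperateGrowth_linFun {d : ℕ} (a : Rd d) : (linFun a).HasTemperateGrowth := by
  unfold linFun
  fun_prop

/-- The operator `Q_v = (i/2π) ∇_v + f_v` on tempered distributions, where, for `v = (a, b)`,
`∇_v = ∑ bᵏ ∂/∂xᵏ` and `f_v(x) = ∑ aᵏ xᵏ`. -/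
def Q {d : ℕ} (v : Rd d × Rd d) (T : 𝓢'(Rd d, ℂ)) : 𝓢'(Rd d, ℂ) :=
  (Complex.I / (2 * Real.pi)) • ∂_{v.2} T +
    TemperedDistribution.smulLeftCLM ℂ (linFun v.1) T

/-- The `L²` norm of a tempered distribution: `‖u‖₂` if it is given by some (necessarily unique)
`u ∈ L²(ℝᵈ)`, and `∞` if it is not in `L²(ℝᵈ)`. -/
def distL2Norm {d : ℕ} (T : 𝓢'(Rd d, ℂ)) : ℝ≥0∞ :=
  ⨅ (u : L2 d) (_ : Lp.toTemperedDistribution u = T), ‖u‖ₑ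

/-- `‖Q_v g‖₂ ∈ [0, ∞]` for `g ∈ L²(ℝᵈ)`, `Q_v g` being taken in the sense of distributions. -/
def normQ {d : ℕ} (v : Rd d × Rd d) (g : L2 d) : ℝ≥0∞ :=
  distL2Norm (Q v (Lp.toTemperedDistribution g))

end BalianLow

end

/-!
The proof compares the two sesquilinear expressions `⟨Q_w g̃, Q_v g⟩` and `⟨Q_v g̃, Q_w g⟩`. Suppose
that `g` and its canonical dual `g̃` both lie in the domains of `Q_v` and `Q_w`.

* An exact frame is biorthogonal to its canonical dual (`IsExactFrame.inner_frameOperatorInv_self`,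
  `IsExactFrame.inner_frameOperatorInv_of_ne`), and the canonical dual of a Gabor frame is the
  Gabor system `T_p g̃`, because the frame operator commutes with the shifts along the lattice
  (`frameOperatorInv_gaborSystem`). Since `Q_v` commutes with `T_p` up to a scalar multiple of
  `T_p`, biorthogonality gives `⟨T_p g̃, Q_v g⟩ = ⟨T_p Q_v g̃, g⟩` for all `p`
  (`HasWeakDeriv.inner_timeFreqShift`). Expanding `⟨Q_w g̃, Q_v g⟩` along the frame and its dual and
  replacing `p` by `-p` then turns it into `⟨Q_v g̃, Q_w g⟩` (`inner_eq_inner_of_isExactFrame`).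
* The difference of the two expressions is a non-zero multiple of `Ω(v, w) ⟨g̃, g⟩`, by the
  canonical commutation relations (`HasWeakDeriv.inner_sub_inner`), and `⟨g̃, g⟩ = 1`. Hence
  `Ω(v, w) = 0`.

Domain questions are handled through the unitary groups `e^{2πitQ_v}`, which are time-frequency
shifts up to a phase: `Q_v g = u` with `u ∈ L²` in the sense of distributions implies that `2πi u` is
the weak derivative of `e^{2πitQ_v} g` at `t = 0` (`hasWeakDeriv_of_eq`). Products of unbounded
operators never appear: covariance, skew-adjointness and the commutation relations are obtained by
differentiating the corresponding identities for unitary operators.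

So one of the four factors is `∞`. None of them is `0`, since `Q_v` is injective on `L²` when
`Ω(v, w) ≠ 0` for some `w` (`normQ_ne_zero`), and the product is `∞`.
-/

namespace BalianLow

/-! ### Frames and their canonical duals -/

section Frames

variable {H : Type*} [NormedAddCommGroup H] [InnerProductSpace ℂ H] {ι : Type*} {f : ι → H}

/-- The coefficients of a vector against a frame are square summable. -/
theorem IsFrame.memℓp (hf : IsFrame f) (x : H) : Memℓp (fun i => inner ℂ (f i) x) 2 := by
  obtain ⟨A, B, hA, h⟩ := hf
  refine (memℓp_gen_iff (by norm_num)).2 ?_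
  simpa using (h x).1

/-- The analysis operator `x ↦ (⟨f i, x⟩)ᵢ` of a frame, with values in `ℓ²`. -/
noncomputable def IsFrame.analysis (hf : IsFrame f) : H →L[ℂ] lp (fun _ : ι => ℂ) 2 :=
  LinearMap.mkContinuousOfExistsBound
    { toFun := fun x => ⟨fun i => inner ℂ (f i) x, hf.memℓp x⟩
      map_add' := fun x y => by ext i; exact inner_add_right _ _ _
      map_smul' := fun c x => by ext i; exact inner_smul_right _ _ _ } <| by
    obtain ⟨A, B, hA, h⟩ := id hf
    refine ⟨√B, fun x => ?_⟩
    refine abs_le_of_sq_le_sq' ?_ (by positivity) |>.2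
    rw [mul_pow]
    have h1 := (h x).2.2
    have hB : 0 ≤ B * ‖x‖ ^ 2 := (tsum_nonneg fun i => by positivity).trans h1
    have h2 := lp.norm_rpow_eq_tsum (p := 2) (by norm_num)
      (⟨fun i => inner ℂ (f i) x, hf.memℓp x⟩ : lp (fun _ : ι => ℂ) 2)
    simp only [ENNReal.toReal_ofNat, Real.rpow_ofNat] at h2
    simp only [LinearMap.coe_mk, AddHom.coe_mk]
    rw [h2]
    rcases (norm_nonneg x).eq_or_lt with hx | hx
    · simpa [← hx] using h1
    · rwa [Real.sq_sqrt (nonneg_of_mul_nonneg_left hB (by positivity))]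

@[simp]
theorem IsFrame.analysis_apply (hf : IsFrame f) (x : H) (i : ι) :
    hf.analysis x i = inner ℂ (f i) x := rfl

theorem IsFrame.norm_analysis_sq (hf : IsFrame f) (x : H) :
    ‖hf.analysis x‖ ^ 2 = ∑' i, ‖inner ℂ (f i) x‖ ^ 2 := by
  have h2 := lp.norm_rpow_eq_tsum (p := 2) (by norm_num) (hf.analysis x)
  simpa using h2

variable [CompleteSpace H]

theorem IsFrame.hasSum_adjoint_analysis (hf : IsFrame f) (c : lp (fun _ : ι => ℂ) 2) :
    HasSum (fun i => c i • f i) (hf.analysis.adjoint c) := by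
  classical
  have h := (lp.hasSum_single (by norm_num) c).mapL hf.analysis.adjoint
  convert h using 2 with i
  refine ext_inner_right ℂ fun y => ?_
  rw [ContinuousLinearMap.adjoint_inner_left]
  simp [lp.inner_single_left, inner_smul_left, mul_comm]

theorem IsFrame.frameOperator_eq (hf : IsFrame f) (x : H) :
    frameOperator f x = hf.analysis.adjoint (hf.analysis x) :=
  (hf.hasSum_adjoint_analysis (hf.analysis x)).tsum_eq

theorem IsFrame.inner_frameOperator_right (hf : IsFrame f) (x y : H) :
    inner ℂ x (frameOperator f y) = inner ℂ (hf.analysis x) (hf.analysis y) := by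
  rw [hf.frameOperator_eq, ContinuousLinearMap.adjoint_inner_right]

theorem IsFrame.inner_frameOperator_left (hf : IsFrame f) (x y : H) :
    inner ℂ (frameOperator f x) y = inner ℂ (hf.analysis x) (hf.analysis y) := by
  rw [hf.frameOperator_eq, ContinuousLinearMap.adjoint_inner_left]

theorem IsFrame.frameOperator_bijective (hf : IsFrame f) :
    Function.Bijective (frameOperator f) := by
  set S : H →L[ℂ] H := hf.analysis.adjoint ∘L hf.analysis with hS
  have hSf : ∀ x, S x = frameOperator f x := fun x => (hf.frameOperator_eq x).symm
  obtain ⟨A, B, hA, h⟩ := id hf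
  have hlow : ∀ x, A * ‖x‖ ≤ ‖S x‖ := fun x => by
    rcases (norm_nonneg x).eq_or_lt with hx | hx
    · simp [← hx]
    · have h1 : A * ‖x‖ ^ 2 ≤ ‖x‖ * ‖S x‖ := by
        refine (h x).2.1.trans ?_
        rw [← hf.norm_analysis_sq, ← inner_self_eq_norm_sq (𝕜 := ℂ),
          ← hf.inner_frameOperator_right, ← hSf]
        exact (RCLike.re_le_norm _).trans (norm_inner_le_norm _ _)
      nlinarith
  have hanti : AntilipschitzWith (Real.toNNReal A⁻¹) S :=
    AddMonoidHomClass.antilipschitz_of_bound S fun x => by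
      rw [Real.coe_toNNReal _ (by positivity), inv_mul_eq_div, le_div_iff₀ hA, mul_comm]
      exact hlow x
  have hclosed : IsClosed (S.range : Set H) :=
    hanti.isClosed_range S.uniformContinuous
  have hrange : S.range = ⊤ := by
    have : CompleteSpace S.range := hclosed.completeSpace_coe
    -- a vector orthogonal to the range is in the kernel of `S`, `S` being self-adjoint
    rw [← Submodule.orthogonal_eq_bot_iff, Submodule.eq_bot_iff]
    intro y hy
    have hy0 : inner ℂ (S y) y = 0 := hy (S y) ⟨y, rfl⟩
    rw [hSf, hf.inner_frameOperator_left, inner_self_eq_zero] at hy0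
    have : S y = 0 := by simp [hS, hy0]
    exact hanti.injective (by simpa using this)
  have : frameOperator f = S := funext fun x => (hSf x).symm
  rw [this]
  exact ⟨hanti.injective, LinearMap.range_eq_top.1 hrange⟩

theorem IsFrame.frameOperator_frameOperatorInv (hf : IsFrame f) (x : H) :
    frameOperator f (frameOperatorInv f x) = x :=
  Function.invFun_eq (hf.frameOperator_bijective.2 x)

/-- The inverse of the frame operator is self-adjoint. -/
theorem IsFrame.inner_frameOperatorInv_left (hf : IsFrame f) (x y : H) :
    inner ℂ (frameOperatorInv f x) y = inner ℂ x (frameOperatorInv f y) := by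
  conv_lhs => rw [← hf.frameOperator_frameOperatorInv y]
  conv_rhs => rw [← hf.frameOperator_frameOperatorInv x]
  rw [hf.inner_frameOperator_left, hf.inner_frameOperator_right]

/-- The reconstruction formula `y = ∑ ⟨S⁻¹ f i, y⟩ f i`. -/
theorem IsFrame.hasSum_frameOperatorInv (hf : IsFrame f) (y : H) :
    HasSum (fun i => inner ℂ (frameOperatorInv f (f i)) y • f i) y := by
  have h := hf.hasSum_adjoint_analysis (hf.analysis (frameOperatorInv f y))
  rw [← hf.frameOperator_eq, hf.frameOperator_frameOperatorInv] at h
  simpa [hf.inner_frameOperatorInv_left] using h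

/-- The polarised form of the reconstruction formula. -/
theorem IsFrame.hasSum_inner_mul_inner (hf : IsFrame f) (x y : H) :
    HasSum (fun i => inner ℂ x (f i) * inner ℂ (frameOperatorInv f (f i)) y) (inner ℂ x y) := by
  have h := (hf.hasSum_frameOperatorInv y).mapL (innerSL ℂ x)
  simpa [inner_smul_right, mul_comm] using h

/-- If the `k`-th diagonal coefficient `⟨S⁻¹ f k, f k⟩` differs from `1`, the reconstruction
formula for `f k` expresses `f k` through the other elements, which therefore still form a
frame. -/
theorem IsFrame.isFrame_ne (hf : IsFrame f) {k : ι}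
    (hk : inner ℂ (frameOperatorInv f (f k)) (f k) ≠ 1) :
    IsFrame (fun i : {i : ι // i ≠ k} => f i) := by
  classical
  obtain ⟨A, B, hA, h⟩ := id hf
  set a : ι → ℂ := fun i => inner ℂ (frameOperatorInv f (f i)) (f k) with ha
  have hasq : Summable fun i => ‖a i‖ ^ 2 := by
    simpa [ha, hf.inner_frameOperatorInv_left] using (h (frameOperatorInv f (f k))).1
  set C : ℝ := ∑' i, ‖a i‖ ^ 2 with hC
  have hC0 : 0 ≤ C := tsum_nonneg fun i => by positivity
  have hd : 0 < ‖1 - a k‖ ^ 2 := by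
    have : 1 - a k ≠ 0 := sub_ne_zero.2 (Ne.symm hk)
    positivity
  set R : H → ℝ := fun x => ∑' i : {i : ι // i ≠ k}, ‖inner ℂ (f i) x‖ ^ 2 with hR
  have hsum : ∀ x, Summable fun i : {i : ι // i ≠ k} => ‖inner ℂ (f i) x‖ ^ 2 := fun x =>
    (h x).1.subtype {i | i ≠ k}
  have hsplit : ∀ x, ∑' i, ‖inner ℂ (f i) x‖ ^ 2 = ‖inner ℂ (f k) x‖ ^ 2 + R x := fun x => by
    have h1 := (h x).1.sum_add_tsum_subtype_compl {k}
    rw [Finset.sum_singleton] at h1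
    rw [← h1]
    congr 1
    exact (Equiv.subtypeEquivRight (by simp)).tsum_eq
      (fun i : {i : ι // i ≠ k} => ‖inner ℂ (f i) x‖ ^ 2)
  have hR0 : ∀ x, 0 ≤ R x := fun x => tsum_nonneg fun i => by positivity
  -- the reconstruction formula gives `(1 - a k) ⟨x, f k⟩ = ∑_{i ≠ k} ⟨x, f i⟩ a i`; Cauchy-Schwarz
  have hkey : ∀ x, ‖1 - a k‖ ^ 2 * ‖inner ℂ (f k) x‖ ^ 2 ≤ C * R x := fun x => by
    have h1 : HasSum (fun i => inner ℂ x (f i) * a i) (inner ℂ x (f k)) :=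
      hf.hasSum_inner_mul_inner x (f k)
    have h2 : HasSum (fun i : {i : ι // i ≠ k} => inner ℂ x (f i) * a i)
        ((1 - a k) * inner ℂ x (f k)) := by
      have h3 := ((hasSum_ite_eq k (inner ℂ x (f k) * a k)))
      have h4 := h1.sub h3
      rw [show (1 - a k) * inner ℂ x (f k) = inner ℂ x (f k) - inner ℂ x (f k) * a k by ring]
      refine ((hasSum_subtype_iff_indicator (s := {i | i ≠ k})
        (f := fun i => inner ℂ x (f i) * a i)).2 ?_)
      refine (congrArg (HasSum · _) (funext fun i => ?_)).mpr h4
      by_cases hi : i = k <;> simp [hi]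
    have h5 := (Real.summable_and_inner_le_Lp_mul_Lq_tsum_of_nonneg (p := 2) (q := 2)
      (f := fun i : {i : ι // i ≠ k} => ‖inner ℂ (f i) x‖)
      (g := fun i : {i : ι // i ≠ k} => ‖a i‖) Real.HolderConjugate.two_two
      (fun i => by positivity) (fun i => by positivity) (by simpa using hsum x)
      (by simp only [Real.rpow_ofNat]; exact hasq.subtype {i | i ≠ k}))
    have h6 : ‖(1 - a k) * inner ℂ x (f k)‖
        ≤ ∑' i : {i : ι // i ≠ k}, ‖inner ℂ (f i) x‖ * ‖a i‖ := by
      rw [← h2.tsum_eq]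
      refine (norm_tsum_le_tsum_norm ?_).trans (le_of_eq ?_)
      · simpa [norm_inner_symm x] using h5.1
      · simp [norm_inner_symm x]
    have h7 : ∑' i : {i : ι // i ≠ k}, ‖a i‖ ^ 2 ≤ C :=
      hasq.tsum_subtype_le _ {i | i ≠ k} fun i => by positivity
    have h8 : ‖(1 - a k) * inner ℂ x (f k)‖ ≤ √(R x) * √C := by
      refine h6.trans (h5.2.trans ?_)
      simp only [Real.rpow_ofNat, ← Real.sqrt_eq_rpow]
      exact mul_le_mul_of_nonneg_left (Real.sqrt_le_sqrt h7) (Real.sqrt_nonneg _)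
    have h9 := pow_le_pow_left₀ (norm_nonneg _) h8 2
    rw [mul_pow, Real.sq_sqrt (hR0 x), Real.sq_sqrt hC0, norm_mul, mul_pow,
      norm_inner_symm x] at h9
    linarith
  refine ⟨A / (1 + C / ‖1 - a k‖ ^ 2), B, by positivity, fun x => ⟨hsum x, ?_, ?_⟩⟩
  · have h1 := (h x).2.1
    rw [hsplit] at h1
    have h2 : ‖inner ℂ (f k) x‖ ^ 2 ≤ C / ‖1 - a k‖ ^ 2 * R x := by
      rw [div_mul_eq_mul_div, le_div_iff₀ hd, mul_comm]
      exact hkey x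
    rw [div_mul_eq_mul_div, div_le_iff₀ (by positivity)]
    change _ ≤ R x * _
    linarith
  · refine le_trans ?_ (h x).2.2
    rw [hsplit]
    change R x ≤ _
    have : 0 ≤ ‖inner ℂ (f k) x‖ ^ 2 := by positivity
    linarith

/-- An exact frame is biorthogonal to its canonical dual, diagonal part. -/
theorem IsExactFrame.inner_frameOperatorInv_self (hf : IsExactFrame f) (k : ι) :
    inner ℂ (frameOperatorInv f (f k)) (f k) = 1 := by
  by_contra h
  exact hf.2 k (hf.1.isFrame_ne h)

/-- An exact frame is biorthogonal to its canonical dual, off-diagonal part: the coefficients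
`⟨S⁻¹ f i, f k⟩` have square sum `⟨S⁻¹ f k, f k⟩ = 1`, all of which is taken by `i = k`. -/
theorem IsExactFrame.inner_frameOperatorInv_of_ne (hf : IsExactFrame f) {i k : ι} (hik : i ≠ k) :
    inner ℂ (frameOperatorInv f (f i)) (f k) = 0 := by
  classical
  obtain ⟨A, B, hA, h⟩ := id hf.1
  have h1 := hf.1.norm_analysis_sq (frameOperatorInv f (f k))
  have h2 := (h (frameOperatorInv f (f k))).1
  have h3 : ‖hf.1.analysis (frameOperatorInv f (f k))‖ ^ 2 = 1 := by
    have := hf.inner_frameOperatorInv_self k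
    conv at this => enter [1, 3]; rw [← hf.1.frameOperator_frameOperatorInv (f k)]
    rw [hf.1.inner_frameOperator_right, inner_self_eq_norm_sq_to_K] at this
    exact Complex.ofReal_injective (by simpa using this)
  have h4 := h2.sum_le_tsum {i, k} fun j _ => by positivity
  rw [← h1, h3, Finset.sum_pair hik, ← hf.1.inner_frameOperatorInv_left,
    ← hf.1.inner_frameOperatorInv_left, hf.inner_frameOperatorInv_self] at h4
  have h5 : ‖inner ℂ (frameOperatorInv f (f i)) (f k)‖ ^ 2 ≤ 0 := by
    simpa using h4
  exact norm_eq_zero.1 (pow_eq_zero_iff two_ne_zero |>.1 (le_antisymm h5 (by positivity)))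

end Frames

end BalianLow

namespace BalianLow

/-! ### Time-frequency shifts -/

/-- The complex phase `e^{2πit}`. -/
noncomputable def phase (t : ℝ) : ℂ := Complex.exp (2 * Real.pi * Complex.I * t)

theorem phase_add (s t : ℝ) : phase (s + t) = phase s * phase t := by
  simp only [phase, ← Complex.exp_add]; push_cast; ring_nf

@[simp]
theorem phase_zero : phase 0 = 1 := by simp [phase]

theorem phase_mul_phase_neg (t : ℝ) : phase t * phase (-t) = 1 := by
  rw [← phase_add]; simp

theorem phase_neg_mul_phase (t : ℝ) : phase (-t) * phase t = 1 := by
  rw [← phase_add]; simp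

theorem conj_phase (t : ℝ) : (starRingEnd ℂ) (phase t) = phase (-t) := by
  simp [phase, ← Complex.exp_conj, Complex.conj_ofNat]

@[simp]
theorem norm_phase (t : ℝ) : ‖phase t‖ = 1 := by
  have : (2 * Real.pi * Complex.I * t : ℂ) = ((2 * Real.pi * t : ℝ) : ℂ) * Complex.I := by
    push_cast; ring
  rw [phase, this, Complex.norm_exp_ofReal_mul_I]

theorem hasDerivAt_phase_mul (c t : ℝ) :
    HasDerivAt (fun t : ℝ => phase (t * c)) (2 * Real.pi * Complex.I * c * phase (t * c)) t := by
  have h : HasDerivAt (fun t : ℝ => (2 * Real.pi * Complex.I * ((t * c : ℝ) : ℂ)))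
      (2 * Real.pi * Complex.I * ((1 * c : ℝ) : ℂ)) t :=
    (((hasDerivAt_id t).mul_const c).ofReal_comp).const_mul _
  simpa [phase, mul_comm] using h.cexp

variable {d : ℕ}

theorem coeFn_timeFreqShift (p : Rd d × Rd d) (g : L2 d) :
    timeFreqShift p g =ᵐ[volume] fun x => phase (inner ℝ p.2 x) * g (x + p.1) :=
  (memLp_shiftFun p g).coeFn_toLp

theorem ae_comp_add_right {P : Rd d → Prop} (h : ∀ᵐ x, P x) (m : Rd d) : ∀ᵐ x, P (x + m) :=
  (measurePreserving_add_right volume m).quasiMeasurePreserving.ae h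

/-- Time-frequency shifts form a projective representation of `ℝ²ᵈ`. -/
theorem timeFreqShift_timeFreqShift (p q : Rd d × Rd d) (g : L2 d) :
    timeFreqShift p (timeFreqShift q g) = phase (inner ℝ q.2 p.1) • timeFreqShift (p + q) g := by
  refine Lp.ext ?_
  filter_upwards [coeFn_timeFreqShift p (timeFreqShift q g), coeFn_timeFreqShift (p + q) g,
    Lp.coeFn_smul (phase (inner ℝ q.2 p.1)) (timeFreqShift (p + q) g),
    ae_comp_add_right (coeFn_timeFreqShift q g) p.1] with x h1 h2 h3 h4
  rw [h1, h3, Pi.smul_apply, h2, h4, smul_eq_mul, ← mul_assoc, ← mul_assoc, ← phase_add,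
    ← phase_add, Prod.snd_add, Prod.fst_add, inner_add_left, inner_add_right, add_assoc]
  congr 2
  ring

@[simp]
theorem timeFreqShift_zero (g : L2 d) : timeFreqShift 0 g = g := by
  refine Lp.ext ?_
  filter_upwards [coeFn_timeFreqShift 0 g] with x h
  simpa using h

theorem timeFreqShift_add (p : Rd d × Rd d) (g h : L2 d) :
    timeFreqShift p (g + h) = timeFreqShift p g + timeFreqShift p h := by
  refine Lp.ext ?_
  filter_upwards [coeFn_timeFreqShift p (g + h), coeFn_timeFreqShift p g, coeFn_timeFreqShift p h,
    Lp.coeFn_add (timeFreqShift p g) (timeFreqShift p h),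
    ae_comp_add_right (Lp.coeFn_add g h) p.1] with x h1 h2 h3 h4 h5
  rw [h1, h4, Pi.add_apply, h2, h3, h5, Pi.add_apply, mul_add]

theorem timeFreqShift_smul (p : Rd d × Rd d) (c : ℂ) (g : L2 d) :
    timeFreqShift p (c • g) = c • timeFreqShift p g := by
  refine Lp.ext ?_
  filter_upwards [coeFn_timeFreqShift p (c • g), coeFn_timeFreqShift p g,
    Lp.coeFn_smul c (timeFreqShift p g),
    ae_comp_add_right (Lp.coeFn_smul c g) p.1] with x h1 h2 h3 h4
  rw [h1, h3, Pi.smul_apply, h2, h4, Pi.smul_apply, smul_eq_mul, smul_eq_mul, mul_left_comm]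

@[simp]
theorem inner_timeFreqShift_timeFreqShift (p : Rd d × Rd d) (g h : L2 d) :
    inner ℂ (timeFreqShift p g) (timeFreqShift p h) = inner ℂ g h := by
  rw [L2.inner_def, L2.inner_def, ← integral_add_right_eq_self (fun x => inner ℂ (g x) (h x)) p.1]
  refine integral_congr_ae ?_
  filter_upwards [coeFn_timeFreqShift p g, coeFn_timeFreqShift p h] with x h1 h2
  rw [h1, h2]
  have := phase_neg_mul_phase (inner ℝ p.2 x)
  simp only [RCLike.inner_apply, map_mul, conj_phase]
  linear_combination (h (x + p.1) * (starRingEnd ℂ) (g (x + p.1))) * this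

@[simp]
theorem norm_timeFreqShift (p : Rd d × Rd d) (g : L2 d) : ‖timeFreqShift p g‖ = ‖g‖ := by
  have h := inner_timeFreqShift_timeFreqShift p g g
  simp only [inner_self_eq_norm_sq_to_K] at h
  exact (sq_eq_sq₀ (norm_nonneg _) (norm_nonneg _)).1
    (Complex.ofReal_injective (by simpa using h))

/-- The time-frequency shift as a linear isometry of `L²`. -/
noncomputable def timeFreqShiftLI (p : Rd d × Rd d) : L2 d →ₗᵢ[ℂ] L2 d where
  toFun := timeFreqShift p
  map_add' := timeFreqShift_add p
  map_smul' := timeFreqShift_smul p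
  norm_map' := norm_timeFreqShift p

theorem inner_timeFreqShift_left (p : Rd d × Rd d) (g h : L2 d) :
    inner ℂ (timeFreqShift p g) h
      = phase (inner ℝ p.2 p.1) * inner ℂ g (timeFreqShift (-p) h) := by
  rw [← inner_timeFreqShift_timeFreqShift p g, timeFreqShift_timeFreqShift, inner_smul_right]
  rw [← mul_assoc, Prod.snd_neg, inner_neg_left, phase_mul_phase_neg]
  simp

theorem inner_timeFreqShift_right (p : Rd d × Rd d) (g h : L2 d) :
    inner ℂ g (timeFreqShift p h)
      = phase (-inner ℝ p.2 p.1) * inner ℂ (timeFreqShift (-p) g) h := by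
  rw [← inner_conj_symm, inner_timeFreqShift_left, map_mul, conj_phase, inner_conj_symm]

theorem symplecticForm_swap (v w : Rd d × Rd d) :
    symplecticForm w v = -symplecticForm v w := by
  rw [symplecticForm, symplecticForm, real_inner_comm v.1 w.2, real_inner_comm v.2 w.1]
  ring

theorem timeFreqShift_comm (p q : Rd d × Rd d) (g : L2 d) :
    timeFreqShift p (timeFreqShift q g)
      = phase (symplecticForm p q) • timeFreqShift q (timeFreqShift p g) := by
  rw [timeFreqShift_timeFreqShift, timeFreqShift_timeFreqShift, smul_smul, ← phase_add,
    add_comm q p, symplecticForm, real_inner_comm p.1 q.2]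
  congr 2
  ring

/-! ### Gabor frames -/

section Gabor

variable {Λ : Submodule ℤ (Rd d × Rd d)} {g : L2 d}

/-- The frame operator of a Gabor system commutes with the time-frequency shifts along the
lattice, the phases in `T_p T_q = e^{2πi…} T_{p+q}` cancelling in `⟨T_p g, ·⟩ T_p g`. -/
theorem frameOperator_gaborSystem_timeFreqShift (hf : IsFrame (gaborSystem Λ g)) (p : Λ)
    (x : L2 d) :
    frameOperator (gaborSystem Λ g) (timeFreqShift p x)
      = timeFreqShift p (frameOperator (gaborSystem Λ g) x) := by
  have h1 := (hf.hasSum_adjoint_analysis (hf.analysis x)).mapL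
    (timeFreqShiftLI (p : Rd d × Rd d)).toContinuousLinearMap
  rw [← hf.frameOperator_eq] at h1
  have h2 := hf.hasSum_adjoint_analysis (hf.analysis (timeFreqShift p x))
  rw [← hf.frameOperator_eq, ← (Equiv.addLeft p).hasSum_iff] at h2
  refine h2.unique ?_
  convert h1 using 1
  swap
  · rfl
  funext q
  have h3 : timeFreqShift ((p : Rd d × Rd d) + (q : Rd d × Rd d)) g
      = phase (-inner ℝ (q : Rd d × Rd d).2 (p : Rd d × Rd d).1) •
        timeFreqShift p (timeFreqShift q g) := by
    rw [timeFreqShift_timeFreqShift, smul_smul, phase_neg_mul_phase, one_smul]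
  change inner ℂ (timeFreqShift ((p : Rd d × Rd d) + (q : Rd d × Rd d)) g) (timeFreqShift p x) •
    timeFreqShift ((p : Rd d × Rd d) + (q : Rd d × Rd d)) g
    = timeFreqShift p (inner ℂ (timeFreqShift q g) x • timeFreqShift q g)
  rw [h3, timeFreqShift_smul, inner_smul_left, conj_phase, inner_timeFreqShift_timeFreqShift,
    smul_smul, mul_right_comm, phase_neg_mul_phase, one_mul]

/-- The canonical dual of a Gabor frame is the Gabor system of the canonical dual window. -/
theorem frameOperatorInv_gaborSystem (hf : IsFrame (gaborSystem Λ g)) (p : Λ) :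
    frameOperatorInv (gaborSystem Λ g) (gaborSystem Λ g p)
      = timeFreqShift p (canonicalDual Λ g) := by
  apply hf.frameOperator_bijective.1
  rw [hf.frameOperator_frameOperatorInv, frameOperator_gaborSystem_timeFreqShift hf, canonicalDual,
    hf.frameOperator_frameOperatorInv]
  rfl

theorem hasSum_gaborSystem (hf : IsFrame (gaborSystem Λ g)) (x y : L2 d) :
    HasSum (fun p : Λ => inner ℂ x (timeFreqShift p g) *
      inner ℂ (timeFreqShift p (canonicalDual Λ g)) y) (inner ℂ x y) := by
  have h := hf.hasSum_inner_mul_inner x y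
  simp only [frameOperatorInv_gaborSystem hf] at h
  exact h

theorem inner_canonicalDual_self (hf : IsExactFrame (gaborSystem Λ g)) :
    inner ℂ (canonicalDual Λ g) g = 1 := by
  have h := hf.inner_frameOperatorInv_self 0
  rw [frameOperatorInv_gaborSystem hf.1] at h
  simpa [gaborSystem] using h

theorem inner_timeFreqShift_canonicalDual (hf : IsExactFrame (gaborSystem Λ g)) {p : Λ}
    (hp : p ≠ 0) : inner ℂ (timeFreqShift p (canonicalDual Λ g)) g = 0 := by
  have h := hf.inner_frameOperatorInv_of_ne hp
  rw [frameOperatorInv_gaborSystem hf.1] at h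
  simpa [gaborSystem] using h

end Gabor

/-! ### The unitary groups generated by `Q` -/

/-- The one-parameter unitary group `e^{2πitQ_v}`: for `v = (a, b)`, it maps `g` to
`x ↦ e^{2πi(t a·x - t² a·b/2)} g(x - tb)`. -/
noncomputable def unitaryGroup (v : Rd d × Rd d) (t : ℝ) (g : L2 d) : L2 d :=
  phase (-(t ^ 2 * inner ℝ v.1 v.2 / 2)) • timeFreqShift (-(t • v.2), t • v.1) g

variable (v w : Rd d × Rd d)

theorem unitaryGroup_add (s t : ℝ) (g : L2 d) :
    unitaryGroup v (s + t) g = unitaryGroup v s (unitaryGroup v t g) := by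
  simp only [unitaryGroup]
  rw [timeFreqShift_smul, timeFreqShift_timeFreqShift, smul_smul, smul_smul, ← phase_add,
    ← phase_add]
  congr 1
  · congr 1
    simp only [inner_neg_right, inner_smul_left, inner_smul_right, conj_trivial]
    ring
  · congr 1
    ext1 <;> simp [add_smul, add_comm]

@[simp]
theorem unitaryGroup_zero (g : L2 d) : unitaryGroup v 0 g = g := by
  have : ((-((0 : ℝ) • v.2), (0 : ℝ) • v.1) : Rd d × Rd d) = 0 := by ext1 <;> simp
  simp only [unitaryGroup, this]
  simp

@[simp]
theorem inner_unitaryGroup_unitaryGroup (t : ℝ) (g h : L2 d) :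
    inner ℂ (unitaryGroup v t g) (unitaryGroup v t h) = inner ℂ g h := by
  simp only [unitaryGroup, inner_smul_left, inner_smul_right, inner_timeFreqShift_timeFreqShift,
    conj_phase]
  rw [← mul_assoc, phase_mul_phase_neg, one_mul]

theorem inner_unitaryGroup_left (t : ℝ) (g h : L2 d) :
    inner ℂ (unitaryGroup v t g) h = inner ℂ g (unitaryGroup v (-t) h) := by
  rw [← inner_unitaryGroup_unitaryGroup v (-t), ← unitaryGroup_add]
  simp

@[simp]
theorem norm_unitaryGroup (t : ℝ) (g : L2 d) : ‖unitaryGroup v t g‖ = ‖g‖ := by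
  simp [unitaryGroup, norm_smul]

theorem unitaryGroup_smul (t : ℝ) (c : ℂ) (g : L2 d) :
    unitaryGroup v t (c • g) = c • unitaryGroup v t g := by
  simp only [unitaryGroup, timeFreqShift_smul]
  rw [smul_comm]

theorem unitaryGroup_timeFreqShift (t : ℝ) (p : Rd d × Rd d) (g : L2 d) :
    unitaryGroup v t (timeFreqShift p g)
      = phase (t * (-inner ℝ v.2 p.2 - inner ℝ v.1 p.1)) •
        timeFreqShift p (unitaryGroup v t g) := by
  simp only [unitaryGroup]
  rw [timeFreqShift_comm, timeFreqShift_smul, smul_comm]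
  congr 2
  simp only [symplecticForm, inner_neg_left, inner_smul_left, conj_trivial]
  ring

/-- The Weyl commutation relations. -/
theorem unitaryGroup_comm (s t : ℝ) (g : L2 d) :
    unitaryGroup v t (unitaryGroup w s g)
      = phase (t * s * symplecticForm v w) • unitaryGroup w s (unitaryGroup v t g) := by
  conv_lhs => rw [unitaryGroup.eq_def w s]
  conv_rhs => rw [unitaryGroup.eq_def w s]
  rw [unitaryGroup_smul, unitaryGroup_timeFreqShift, smul_comm]
  congr 2
  simp only [symplecticForm, inner_neg_right, inner_smul_right]
  ring

end BalianLow

namespace BalianLow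

/-! ### Weak derivatives along the unitary groups -/

variable {d : ℕ}

/-- `u` is the weak derivative at `t = 0` of `t ↦ e^{2πitQ_v} g`, that is, `u = 2πi Q_v g`. -/
def HasWeakDeriv (v : Rd d × Rd d) (g u : L2 d) : Prop :=
  ∀ h : L2 d, HasDerivAt (fun t : ℝ => inner ℂ h (unitaryGroup v t g)) (inner ℂ h u) 0

namespace HasWeakDeriv

variable {v w : Rd d × Rd d} {g u γ s : L2 d}

theorem inner_left (hg : HasWeakDeriv v g u) (h : L2 d) :
    HasDerivAt (fun t : ℝ => inner ℂ (unitaryGroup v t g) h) (inner ℂ u h) 0 := by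
  have := (hg h).star
  simpa [← starRingEnd_apply, inner_conj_symm] using this

/-- Since `⟨e^{-2πitQ_v} g, h⟩ = ⟨g, e^{2πitQ_v} h⟩`, this expresses that the generator is
skew-adjoint. -/
theorem inner_left_neg (hg : HasWeakDeriv v g u) (h : L2 d) :
    HasDerivAt (fun t : ℝ => inner ℂ (unitaryGroup v (-t) g) h) (-inner ℂ u h) 0 := by
  have := HasDerivAt.scomp (𝕜 := ℝ) (𝕜' := ℝ) (0 : ℝ) (h := fun t : ℝ => -t) (h' := -1)
    (g₁ := fun t : ℝ => inner ℂ (unitaryGroup v t g) h) (g₁' := inner ℂ u h)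
    (by simpa using hg.inner_left h) (hasDerivAt_neg (0 : ℝ))
  simpa [Function.comp_def] using this

/-- Skew-adjointness of the generator combined with its covariance
`e^{2πitQ_v} T_p = e^{2πict} T_p e^{2πitQ_v}`: the extra term coming from the phase is a multiple
of `c ⟨T_p γ, g⟩`, which is assumed to vanish. -/
theorem inner_timeFreqShift (hg : HasWeakDeriv v g u) (hγ : HasWeakDeriv v γ s)
    {p : Rd d × Rd d} (hp : p = 0 ∨ inner ℂ (timeFreqShift p γ) g = 0) :
    inner ℂ (timeFreqShift p γ) u = -inner ℂ (timeFreqShift p s) g := by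
  set c : ℝ := -inner ℝ v.2 p.2 - inner ℝ v.1 p.1 with hc
  have h1 := hg (timeFreqShift p γ)
  have h2 : ∀ t : ℝ, inner ℂ (timeFreqShift p γ) (unitaryGroup v t g)
      = phase (t * c) * (phase (inner ℝ p.2 p.1) *
        inner ℂ (unitaryGroup v (-t) γ) (timeFreqShift (-p) g)) := fun t => by
    have h3 := inner_unitaryGroup_left v (-t) (timeFreqShift p γ) g
    rw [neg_neg] at h3
    rw [← h3, unitaryGroup_timeFreqShift, inner_smul_left, conj_phase, ← hc,
      inner_timeFreqShift_left, neg_mul, neg_neg]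
  simp_rw [h2] at h1
  have h4 := (hasDerivAt_phase_mul c 0).mul
    ((hγ.inner_left_neg (timeFreqShift (-p) g)).const_mul (phase (inner ℝ p.2 p.1)))
  have h5 := h1.unique h4
  rw [h5]
  have h6 : (c : ℂ) * inner ℂ (timeFreqShift p γ) g = 0 := by
    rcases hp with rfl | hp
    · simp [hc]
    · rw [hp, mul_zero]
  rw [inner_timeFreqShift_left] at h6
  rw [inner_timeFreqShift_left]
  simp only [zero_mul, neg_zero, phase_zero, unitaryGroup_zero]
  linear_combination (2 * Real.pi * Complex.I) * h6

/-- The canonical commutation relation `[Q_v, Q_w] = (i/2π) Ω(v, w)` in weak form: the Weyl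
relations, differentiated in both parameters one after the other. -/
theorem inner_sub_inner {uv uw sv sw : L2 d} (hgv : HasWeakDeriv v g uv)
    (hgw : HasWeakDeriv w g uw) (hγv : HasWeakDeriv v γ sv) (hγw : HasWeakDeriv w γ sw) :
    inner ℂ sv uw - inner ℂ sw uv
      = 2 * Real.pi * Complex.I * symplecticForm w v * inner ℂ γ g := by
  have h1 : ∀ s t : ℝ, inner ℂ (unitaryGroup w (-s) γ) (unitaryGroup v t g)
      = phase (s * (t * symplecticForm w v)) *
        inner ℂ (unitaryGroup v (-t) γ) (unitaryGroup w s g) := fun s t => by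
    rw [inner_unitaryGroup_left, inner_unitaryGroup_left, neg_neg, neg_neg, unitaryGroup_comm,
      inner_smul_right, mul_assoc]
  -- differentiation in `s` at `s = 0`, with `t` fixed
  have h2 : ∀ t : ℝ, -inner ℂ sw (unitaryGroup v t g)
      = 2 * Real.pi * Complex.I * ((t * symplecticForm w v : ℝ) : ℂ) *
        inner ℂ (unitaryGroup v (-t) γ) g + inner ℂ (unitaryGroup v (-t) γ) uw := fun t => by
    have h3 := hγw.inner_left_neg (unitaryGroup v t g)
    simp_rw [h1] at h3
    have h4 := (hasDerivAt_phase_mul (t * symplecticForm w v) 0).mul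
      (hgw (unitaryGroup v (-t) γ))
    simpa using h3.unique h4
  -- differentiation in `t` at `t = 0`
  have h5 := (hgv sw).neg
  have h6 : HasDerivAt (fun t : ℝ => 2 * Real.pi * Complex.I * ((t * symplecticForm w v : ℝ) : ℂ))
      (2 * Real.pi * Complex.I * ((1 * symplecticForm w v : ℝ) : ℂ)) 0 :=
    (((hasDerivAt_id (0 : ℝ)).mul_const _).ofReal_comp).const_mul _
  have h7 := (h6.mul (hγv.inner_left_neg g)).add (hγv.inner_left_neg uw)
  have h8 := h5.unique (h7.congr_of_eventuallyEq (Filter.Eventually.of_forall h2))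
  simp only [zero_mul, one_mul, neg_zero, unitaryGroup_zero, Complex.ofReal_zero, mul_zero] at h8
  linear_combination h8

end HasWeakDeriv

/-- Biorthogonality forces the commutator form to vanish on an exact Gabor frame and its dual:
expanding `⟨Q_w γ, Q_v g⟩` along the frame and moving `Q_v`, `Q_w` across each inner product turns
the sum, read in the order `p ↦ -p`, into the expansion of `⟨Q_v γ, Q_w g⟩`. -/
theorem inner_eq_inner_of_isExactFrame {Λ : Submodule ℤ (Rd d × Rd d)} {g : L2 d}
    (hg : IsExactFrame (gaborSystem Λ g)) {v w : Rd d × Rd d} {uv uw sv sw : L2 d}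
    (hgv : HasWeakDeriv v g uv) (hgw : HasWeakDeriv w g uw)
    (hγv : HasWeakDeriv v (canonicalDual Λ g) sv) (hγw : HasWeakDeriv w (canonicalDual Λ g) sw) :
    inner ℂ sw uv = inner ℂ sv uw := by
  set γ := canonicalDual Λ g
  have hbi : ∀ p : Λ, (p : Rd d × Rd d) = 0 ∨ inner ℂ (timeFreqShift (p : Rd d × Rd d) γ) g = 0 :=
    fun p => by
      by_cases hp : p = 0
      · exact Or.inl (by simp [hp])
      · exact Or.inr (inner_timeFreqShift_canonicalDual hg hp)
  have h1 := hasSum_gaborSystem hg.1 sw uv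
  have h2 := hasSum_gaborSystem hg.1 sv uw
  rw [← (Equiv.neg Λ).hasSum_iff] at h2
  refine h1.unique ((congrArg (HasSum · _) (funext fun p => ?_)).mp h2)
  have h3 := hgv.inner_timeFreqShift hγv (hbi p)
  have h4 := hgw.inner_timeFreqShift hγw (hbi (-p))
  simp only [Function.comp_apply, Equiv.neg_apply, Submodule.coe_neg] at h4 ⊢
  rw [h4, h3, inner_timeFreqShift_right (p : Rd d × Rd d) sw,
    inner_timeFreqShift_left (p : Rd d × Rd d) sv]
  have h5 := phase_neg_mul_phase (inner ℝ (p : Rd d × Rd d).2 (p : Rd d × Rd d).1)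
  linear_combination (inner ℂ sv (timeFreqShift (-(p : Rd d × Rd d)) g) *
    inner ℂ (timeFreqShift (-(p : Rd d × Rd d)) sw) g) * h5

/-- An exact Gabor frame and its canonical dual cannot both lie in the domains of two
non-commuting operators `Q_v` and `Q_w`. -/
theorem symplecticForm_eq_zero_of_hasWeakDeriv {Λ : Submodule ℤ (Rd d × Rd d)} {g : L2 d}
    (hg : IsExactFrame (gaborSystem Λ g)) {v w : Rd d × Rd d} {uv uw sv sw : L2 d}
    (hgv : HasWeakDeriv v g uv) (hgw : HasWeakDeriv w g uw)
    (hγv : HasWeakDeriv v (canonicalDual Λ g) sv) (hγw : HasWeakDeriv w (canonicalDual Λ g) sw) :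
    symplecticForm v w = 0 := by
  have h := hgv.inner_sub_inner hgw hγv hγw
  rw [inner_eq_inner_of_isExactFrame hg hgv hgw hγv hγw, sub_self, inner_canonicalDual_self hg,
    mul_one] at h
  simpa [symplecticForm_swap v w, Real.pi_ne_zero] using h.symm

end BalianLow

namespace BalianLow

/-! ### The action of the unitary groups on Schwartz functions -/

variable {d : ℕ}

theorem hasTemperateGrowth_phase : phase.HasTemperateGrowth := by
  have h1 : ∀ n : ℕ, iteratedDeriv n phase = fun t => (2 * Real.pi * Complex.I) ^ n * phase t := by
    intro n
    induction n with
    | zero => simp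
    | succ n ih =>
      rw [iteratedDeriv_succ, ih]
      funext t
      have h := (hasDerivAt_phase_mul 1 t).const_mul ((2 * Real.pi * Complex.I) ^ n)
      simp only [mul_one, Complex.ofReal_one] at h
      rw [h.deriv]
      ring
  refine ⟨?_, fun n => ⟨0, ‖(2 * Real.pi * Complex.I : ℂ)‖ ^ n, fun t => ?_⟩⟩
  · exact (contDiff_const.mul Complex.ofRealCLM.contDiff).cexp
  · rw [norm_iteratedFDeriv_eq_norm_iteratedDeriv, h1]
    simp

theorem hasTemperateGrowth_phase_inner (a : Rd d) :
    (fun x : Rd d => phase (inner ℝ a x)).HasTemperateGrowth :=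
  hasTemperateGrowth_phase.comp (Function.hasTemperateGrowth_inner_right a)

/-- The time-frequency shift of a Schwartz function. -/
noncomputable def schwartzShift (p : Rd d × Rd d) (φ : 𝓢(Rd d, ℂ)) : 𝓢(Rd d, ℂ) :=
  SchwartzMap.smulLeftCLM ℂ (fun x => phase (inner ℝ p.2 x))
    (SchwartzMap.compSubConstCLM ℂ (-p.1) φ)

theorem schwartzShift_apply (p : Rd d × Rd d) (φ : 𝓢(Rd d, ℂ)) (x : Rd d) :
    schwartzShift p φ x = phase (inner ℝ p.2 x) * φ (x + p.1) := by
  rw [schwartzShift, SchwartzMap.smulLeftCLM_apply_apply (hasTemperateGrowth_phase_inner p.2)]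
  simp

theorem timeFreqShift_toLp (p : Rd d × Rd d) (φ : 𝓢(Rd d, ℂ)) :
    timeFreqShift p (φ.toLp 2) = (schwartzShift p φ).toLp 2 := by
  refine Lp.ext ?_
  filter_upwards [coeFn_timeFreqShift p (φ.toLp 2), (schwartzShift p φ).coeFn_toLp 2,
    ae_comp_add_right (φ.coeFn_toLp 2 volume) p.1] with x h1 h2 h3
  rw [h1, h2, schwartzShift_apply, h3]

theorem unitaryGroup_toLp (v : Rd d × Rd d) (t : ℝ) (φ : 𝓢(Rd d, ℂ)) :
    ∃ ψ : 𝓢(Rd d, ℂ), unitaryGroup v t (φ.toLp 2) = ψ.toLp 2 := by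
  refine ⟨phase (-(t ^ 2 * inner ℝ v.1 v.2 / 2)) • schwartzShift (-(t • v.2), t • v.1) φ, ?_⟩
  rw [unitaryGroup, timeFreqShift_toLp]
  rfl

/-- The complex conjugate of a Schwartz function. -/
noncomputable def schwartzConj (φ : 𝓢(Rd d, ℂ)) : 𝓢(Rd d, ℂ) :=
  φ.postcompCLM (Complex.conjCLE : ℂ →L[ℝ] ℂ)

@[simp]
theorem schwartzConj_apply (φ : 𝓢(Rd d, ℂ)) (x : Rd d) :
    schwartzConj φ x = (starRingEnd ℂ) (φ x) := rfl

/-- The formal adjoint of `2πi Q_v` with respect to the bilinear pairing `∫ φ g`. -/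
noncomputable def schwartzGen (v : Rd d × Rd d) (φ : 𝓢(Rd d, ℂ)) : 𝓢(Rd d, ℂ) :=
  ∂_{v.2} φ + (2 * Real.pi * Complex.I : ℂ) • SchwartzMap.smulLeftCLM ℂ (linFun v.1) φ

theorem schwartzGen_apply (v : Rd d × Rd d) (φ : 𝓢(Rd d, ℂ)) (x : Rd d) :
    schwartzGen v φ x = fderiv ℝ φ x v.2 + 2 * Real.pi * Complex.I * (linFun v.1 x * φ x) := by
  simp [schwartzGen, SchwartzMap.smulLeftCLM_apply_apply (hasTemperateGrowth_linFun v.1),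
    SchwartzMap.lineDerivOp_apply_eq_fderiv]

theorem inner_toLp_unitaryGroup (v : Rd d × Rd d) (t : ℝ) (φ : 𝓢(Rd d, ℂ)) (h : L2 d) :
    inner ℂ (φ.toLp 2) (unitaryGroup v t h)
      = ∫ x, phase (t * inner ℝ v.1 x + t ^ 2 * inner ℝ v.1 v.2 / 2) *
          schwartzConj φ (x + t • v.2) * h x := by
  have h0 := inner_unitaryGroup_left v (-t) (φ.toLp 2 : L2 d) h
  rw [neg_neg] at h0
  rw [← h0, unitaryGroup, timeFreqShift_toLp, inner_smul_left, L2.inner_def,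
    ← integral_const_mul]
  refine integral_congr_ae ?_
  filter_upwards [(schwartzShift (-(-t • v.2), -t • v.1) φ).coeFn_toLp 2] with x hx
  rw [hx, schwartzShift_apply, phase_add]
  simp only [RCLike.inner_apply, map_mul, conj_phase, schwartzConj_apply, inner_smul_left,
    neg_smul, neg_neg, inner_neg_left, neg_sq, conj_trivial]
  ring

/-- The functions of `t` in `inner_toLp_unitaryGroup` solve the transport equation of `v` pointwise,
at every `t` and not only at `t = 0`, because the generator commutes with its group. -/
theorem hasDerivAt_phase_mul_schwartz (v : Rd d × Rd d) (φ : 𝓢(Rd d, ℂ)) (x : Rd d) (t : ℝ) :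
    HasDerivAt (fun t : ℝ => phase (t * inner ℝ v.1 x + t ^ 2 * inner ℝ v.1 v.2 / 2) *
        φ (x + t • v.2))
      (phase (t * inner ℝ v.1 x + t ^ 2 * inner ℝ v.1 v.2 / 2) * schwartzGen v φ (x + t • v.2))
      t := by
  have h1 : HasDerivAt (fun t : ℝ => φ (x + t • v.2)) (fderiv ℝ φ (x + t • v.2) v.2) t := by
    have h2 : HasDerivAt (fun t : ℝ => x + t • v.2) ((1 : ℝ) • v.2) t :=
      ((hasDerivAt_id t).smul_const v.2).const_add x
    rw [one_smul] at h2
    exact φ.differentiableAt.hasFDerivAt.comp_hasDerivAt t h2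
  have h3 : HasDerivAt (fun t : ℝ => t * inner ℝ v.1 x + t ^ 2 * inner ℝ v.1 v.2 / 2)
      (inner ℝ v.1 (x + t • v.2)) t := by
    have := ((hasDerivAt_id t).mul_const (inner ℝ v.1 x)).add
      ((((hasDerivAt_id t).pow 2).mul_const (inner ℝ v.1 v.2)).div_const 2)
    refine this.congr_deriv ?_
    simp only [id, inner_add_right, inner_smul_right]
    push_cast
    ring
  have h4 := (hasDerivAt_phase_mul 1 (t * inner ℝ v.1 x + t ^ 2 * inner ℝ v.1 v.2 / 2)).scomp t h3
  simp only [mul_one, Function.comp_def] at h4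
  refine (h4.mul h1).congr_deriv ?_
  rw [schwartzGen_apply, linFun, Complex.real_smul]
  push_cast
  ring

/-- A dominating function for all the translates of a Schwartz function by bounded vectors. -/
theorem exists_norm_comp_add_le (ψ : 𝓢(Rd d, ℂ)) (b : Rd d) :
    ∃ K : ℝ, ∀ t ∈ Metric.ball (0 : ℝ) 1, ∀ x,
      ‖ψ (x + t • b)‖ ≤ K * (1 + ‖x‖) ^ (-(d + 1 : ℝ)) := by
  obtain ⟨C, hC⟩ : ∃ C, ∀ y, (1 + ‖y‖) ^ (d + 1) * ‖ψ y‖ ≤ C :=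
    ⟨_, fun y => by
      simpa using SchwartzMap.one_add_le_sup_seminorm_apply (𝕜 := ℝ) (m := (d + 1, 0))
        (k := d + 1) (n := 0) le_rfl le_rfl ψ y⟩
  refine ⟨(1 + ‖b‖) ^ (d + 1) * C, fun t ht x => ?_⟩
  rw [mem_ball_zero_iff, Real.norm_eq_abs] at ht
  rw [Real.rpow_neg (by positivity), ← div_eq_mul_inv, le_div_iff₀ (by positivity)]
  have h1 : (1 + ‖x‖) ≤ (1 + ‖b‖) * (1 + ‖x + t • b‖) := by
    have h2 : ‖x‖ ≤ ‖x + t • b‖ + ‖t • b‖ := by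
      simpa using norm_sub_le (x + t • b) (t • b)
    rw [norm_smul, Real.norm_eq_abs] at h2
    nlinarith [norm_nonneg b, norm_nonneg (x + t • b), abs_nonneg t]
  have h3 : (1 + ‖x‖) ^ (d + 1 : ℝ) = (1 + ‖x‖) ^ (d + 1) := by
    exact_mod_cast Real.rpow_natCast (1 + ‖x‖) (d + 1)
  rw [h3]
  calc ‖ψ (x + t • b)‖ * (1 + ‖x‖) ^ (d + 1)
      ≤ ‖ψ (x + t • b)‖ * ((1 + ‖b‖) * (1 + ‖x + t • b‖)) ^ (d + 1) := by gcongr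
    _ = (1 + ‖b‖) ^ (d + 1) * ((1 + ‖x + t • b‖) ^ (d + 1) * ‖ψ (x + t • b)‖) := by
        rw [mul_pow]; ring
    _ ≤ _ := by gcongr; exact hC _

theorem memLp_two_one_add_norm_rpow :
    MemLp (fun x : Rd d => (1 + ‖x‖) ^ (-(d + 1 : ℝ))) 2 volume := by
  have hm : AEStronglyMeasurable (fun x : Rd d => (1 + ‖x‖) ^ (-(d + 1 : ℝ))) volume :=
    Continuous.aestronglyMeasurable
      ((by fun_prop : Continuous fun x : Rd d => 1 + ‖x‖).rpow_const fun x =>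
        Or.inl (by positivity))
  refine (memLp_two_iff_integrable_sq hm).2 ?_
  have h := integrable_one_add_norm (E := Rd d) (μ := volume) (r := 2 * (d + 1))
    (by simp only [finrank_euclideanSpace, Fintype.card_fin]; linarith [d.cast_nonneg (α := ℝ)])
  refine h.congr (Filter.Eventually.of_forall fun x => ?_)
  dsimp only
  rw [← Real.rpow_mul_natCast (by positivity)]
  congr 1
  push_cast
  ring

/-- Differentiation of the action of the unitary group on a Schwartz function under the
integral sign. -/
theorem hasDerivAt_inner_toLp_unitaryGroup (v : Rd d × Rd d) (φ : 𝓢(Rd d, ℂ)) (h : L2 d) :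
    HasDerivAt (fun t : ℝ => inner ℂ (φ.toLp 2) (unitaryGroup v t h))
      (∫ x, schwartzGen v (schwartzConj φ) x * h x) 0 := by
  simp_rw [inner_toLp_unitaryGroup]
  set χ := schwartzConj φ with hχ
  obtain ⟨K, hK⟩ := exists_norm_comp_add_le (schwartzGen v χ) v.2
  have hph : ∀ t : ℝ, Continuous fun x : Rd d =>
      phase (t * inner ℝ v.1 x + t ^ 2 * inner ℝ v.1 v.2 / 2) := fun t => by
    unfold phase
    fun_prop
  have hmeas : ∀ (ψ : 𝓢(Rd d, ℂ)) (t : ℝ), AEStronglyMeasurable (fun x =>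
      phase (t * inner ℝ v.1 x + t ^ 2 * inner ℝ v.1 v.2 / 2) * ψ (x + t • v.2) * h x) volume :=
    fun ψ t => (((hph t).mul (ψ.continuous.comp (by fun_prop))).aestronglyMeasurable).mul
      (Lp.aestronglyMeasurable h)
  have key := hasDerivAt_integral_of_dominated_loc_of_deriv_le (μ := volume)
    (F := fun (t : ℝ) x => phase (t * inner ℝ v.1 x + t ^ 2 * inner ℝ v.1 v.2 / 2) *
      χ (x + t • v.2) * h x)
    (F' := fun (t : ℝ) x => phase (t * inner ℝ v.1 x + t ^ 2 * inner ℝ v.1 v.2 / 2) *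
      schwartzGen v χ (x + t • v.2) * h x)
    (bound := fun x => K * ((1 + ‖x‖) ^ (-(d + 1 : ℝ)) * ‖h x‖))
    (x₀ := (0 : ℝ)) (Metric.ball_mem_nhds 0 one_pos)
    (Filter.Eventually.of_forall fun t => hmeas χ t) ?_ (hmeas _ 0) ?_ ?_ ?_
  · simpa using key.2
  · have := (χ.memLp 2 (volume : Measure (Rd d))).integrable_mul (Lp.memLp h)
    simpa [Pi.mul_def] using this
  · refine Filter.Eventually.of_forall fun x t ht => ?_
    rw [norm_mul, norm_mul, norm_phase, one_mul, ← mul_assoc]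
    exact mul_le_mul_of_nonneg_right (hK t ht x) (norm_nonneg _)
  · exact (memLp_two_one_add_norm_rpow.integrable_mul (Lp.memLp h).norm).const_mul K
  · exact Filter.Eventually.of_forall fun x t _ =>
      (hasDerivAt_phase_mul_schwartz v χ x t).mul_const (h x)

theorem denseRange_schwartz_toLp :
    DenseRange (fun φ : 𝓢(Rd d, ℂ) => (φ.toLp 2 : L2 d)) :=
  SchwartzMap.denseRange_toLpCLM (by norm_num)

end BalianLow

namespace BalianLow

/-! ### From distributions to weak derivatives -/

variable {d : ℕ} {v w : Rd d × Rd d} {g u : L2 d}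

/-- The distributional equation `Q_v g = u`, tested against the conjugate of a Schwartz function. -/
theorem integral_schwartzGen_mul (hu : Lp.toTemperedDistribution u =
    Q v (Lp.toTemperedDistribution g)) (φ : 𝓢(Rd d, ℂ)) :
    ∫ x, schwartzGen v (schwartzConj φ) x * g x
      = 2 * Real.pi * Complex.I * inner ℂ (φ.toLp 2 volume) u := by
  have h1 : Lp.toTemperedDistribution g (schwartzGen v (schwartzConj φ))
      = 2 * Real.pi * Complex.I * Lp.toTemperedDistribution u (schwartzConj φ) := by
    have hπ : (Real.pi : ℂ) ≠ 0 := by exact_mod_cast Real.pi_ne_zero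
    have hQ : Q v (Lp.toTemperedDistribution g) (schwartzConj φ)
        = Complex.I / (2 * Real.pi) * Lp.toTemperedDistribution g (-∂_{v.2} (schwartzConj φ))
          + Lp.toTemperedDistribution g
            (SchwartzMap.smulLeftCLM ℂ (linFun v.1) (schwartzConj φ)) := rfl
    rw [hu, hQ, schwartzGen, map_add, map_smul, map_neg, smul_eq_mul]
    field_simp
    linear_combination (Lp.toTemperedDistribution g (∂_{v.2} (schwartzConj φ))) * Complex.I_sq
  have h2 : Lp.toTemperedDistribution u (schwartzConj φ) = inner ℂ (φ.toLp 2 volume) u := by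
    rw [Lp.toTemperedDistribution_apply, L2.inner_def]
    refine integral_congr_ae ?_
    filter_upwards [φ.coeFn_toLp 2] with x hx
    rw [hx, schwartzConj_apply, RCLike.inner_apply, smul_eq_mul, mul_comm]
  rw [← h2, ← h1, Lp.toTemperedDistribution_apply]
  rfl

/-- Along Schwartz functions `t ↦ e^{2πitQ_v} g` has the derivative `e^{2πitQ_v} 2πi Q_v g`. -/
theorem hasDerivAt_inner_toLp_unitaryGroup_of_eq (hu : Lp.toTemperedDistribution u =
    Q v (Lp.toTemperedDistribution g)) (φ : 𝓢(Rd d, ℂ)) (t : ℝ) :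
    HasDerivAt (fun t : ℝ => inner ℂ (φ.toLp 2 volume) (unitaryGroup v t g))
      (2 * Real.pi * Complex.I * inner ℂ (φ.toLp 2 volume) (unitaryGroup v t u)) t := by
  obtain ⟨ψ, hψ⟩ := unitaryGroup_toLp v (-t) φ
  have h1 := hasDerivAt_inner_toLp_unitaryGroup v ψ g
  rw [integral_schwartzGen_mul hu, ← hψ, inner_unitaryGroup_left, neg_neg] at h1
  have h2 : HasDerivAt (fun s : ℝ => s - t) 1 t := (hasDerivAt_id t).sub_const t
  have h3 := HasDerivAt.scomp (𝕜 := ℝ) (𝕜' := ℝ) t (h := fun s : ℝ => s - t)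
    (by rw [sub_self]; exact h1) h2
  rw [one_smul] at h3
  refine h3.congr_of_eventuallyEq (Filter.Eventually.of_forall fun s => ?_)
  rw [Function.comp_apply, inner_unitaryGroup_left, neg_neg, ← unitaryGroup_add]
  simp

/-- The mean value inequality for `t ↦ ⟨φ, e^{2πitQ_v} g⟩`, uniformly in Schwartz functions `φ`. -/
theorem norm_unitaryGroup_sub_le (hu : Lp.toTemperedDistribution u =
    Q v (Lp.toTemperedDistribution g)) (t : ℝ) :
    ‖unitaryGroup v t g - g‖ ≤ 2 * Real.pi * ‖u‖ * |t| := by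
  have h1 : ∀ h : L2 d, ‖inner ℂ h (unitaryGroup v t g - g)‖ ≤ ‖h‖ * (2 * Real.pi * ‖u‖ * |t|) := by
    intro h
    refine denseRange_schwartz_toLp.induction_on (p := fun h : L2 d =>
      ‖inner ℂ h (unitaryGroup v t g - g)‖ ≤ ‖h‖ * (2 * Real.pi * ‖u‖ * |t|)) h
      (isClosed_le (by fun_prop) (by fun_prop)) fun φ => ?_
    have h2 := convex_univ.norm_image_sub_le_of_norm_hasDerivWithin_le
      (f := fun t : ℝ => inner ℂ (φ.toLp 2 : L2 d) (unitaryGroup v t g))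
      (fun s _ => (hasDerivAt_inner_toLp_unitaryGroup_of_eq hu φ s).hasDerivWithinAt)
      (C := 2 * Real.pi * (‖(φ.toLp 2 : L2 d)‖ * ‖u‖)) (fun s _ => by
        have := norm_inner_le_norm (𝕜 := ℂ) (φ.toLp 2 : L2 d) (unitaryGroup v s u)
        rw [norm_unitaryGroup] at this
        simp only [norm_mul, Complex.norm_ofNat, Complex.norm_I, mul_one, Complex.norm_real,
          Real.norm_of_nonneg Real.pi_nonneg]
        gcongr) (Set.mem_univ 0) (Set.mem_univ t)
    rw [unitaryGroup_zero, ← inner_sub_right, sub_zero, Real.norm_eq_abs] at h2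
    linarith
  have h3 := h1 (unitaryGroup v t g - g)
  rw [inner_self_eq_norm_sq_to_K] at h3
  rcases (norm_nonneg (unitaryGroup v t g - g)).eq_or_lt with h0 | h0
  · rw [← h0]; positivity
  · refine le_of_mul_le_mul_left ?_ h0
    simpa [pow_two] using h3

/-- If `Q_v g = u` in the sense of distributions, with `g, u ∈ L²`, then `2πi u` is the weak
derivative of `e^{2πitQ_v} g`: it is so along the dense set of Schwartz functions, and the
difference quotients are bounded in `L²`. -/
theorem hasWeakDeriv_of_eq (hu : Lp.toTemperedDistribution u =
    Q v (Lp.toTemperedDistribution g)) :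
    HasWeakDeriv v g ((2 * Real.pi * Complex.I : ℂ) • u) := by
  intro h
  set u' : L2 d := (2 * Real.pi * Complex.I : ℂ) • u with hu'
  have hC : ∀ t : ℝ, ‖unitaryGroup v t g - g - (t : ℂ) • u'‖ ≤ 4 * Real.pi * ‖u‖ * |t| := fun t => by
    have h1 : ‖(t : ℂ) • u'‖ = 2 * Real.pi * ‖u‖ * |t| := by
      simp only [hu', norm_smul, norm_mul, Complex.norm_ofNat, Complex.norm_I, mul_one,
        Complex.norm_real, Real.norm_of_nonneg Real.pi_nonneg, Real.norm_eq_abs]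
      ring
    have h2 := norm_sub_le (unitaryGroup v t g - g) ((t : ℂ) • u')
    have h3 := norm_unitaryGroup_sub_le hu t
    linarith
  have hrw : ∀ (h : L2 d) (t : ℝ), inner ℂ h (unitaryGroup v t g)
      - inner ℂ h (unitaryGroup v 0 g) - (t - 0) • inner ℂ h u'
      = inner ℂ h (unitaryGroup v t g - g - (t : ℂ) • u') := fun h t => by
    rw [inner_sub_right, inner_sub_right, inner_smul_right h u' (t : ℂ), unitaryGroup_zero, sub_zero,
      Complex.real_smul]
  rw [hasDerivAt_iff_isLittleO, Asymptotics.isLittleO_iff]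
  intro c hc
  set M := 4 * Real.pi * ‖u‖ with hM
  have hM0 : 0 ≤ M := by positivity
  obtain ⟨φ, hφ⟩ := denseRange_schwartz_toLp.exists_dist_lt h
    (show 0 < c / 2 / (M + 1) by positivity)
  have h1 := hasDerivAt_inner_toLp_unitaryGroup_of_eq hu φ 0
  rw [unitaryGroup_zero, ← inner_smul_right, ← hu', hasDerivAt_iff_isLittleO,
    Asymptotics.isLittleO_iff] at h1
  filter_upwards [h1 (half_pos hc)] with t ht
  rw [hrw, sub_zero, Real.norm_eq_abs] at ht ⊢
  rw [dist_eq_norm] at hφ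
  have h2 : inner ℂ h (unitaryGroup v t g - g - (t : ℂ) • u')
      = inner ℂ (h - φ.toLp 2 volume) (unitaryGroup v t g - g - (t : ℂ) • u')
        + inner ℂ (φ.toLp 2 volume) (unitaryGroup v t g - g - (t : ℂ) • u') := by
    rw [inner_sub_left]; ring
  have h3 : ‖inner ℂ (h - φ.toLp 2 volume) (unitaryGroup v t g - g - (t : ℂ) • u')‖ ≤ c / 2 * |t| := by
    refine (norm_inner_le_norm _ _).trans ?_
    calc _ ≤ c / 2 / (M + 1) * (M * |t|) := by gcongr; exact hC t
      _ ≤ c / 2 / (M + 1) * ((M + 1) * |t|) := by gcongr; linarith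
      _ = c / 2 * |t| := by field_simp
  rw [h2]
  refine (norm_add_le _ _).trans ?_
  linarith

/-! ### `Q` is injective on `L²` -/

/-- A vector invariant under `e^{2πitQ_v}` is orthogonal to its images under `e^{2πisQ_w}`,
`s ≠ 0`, which are eigenvectors for non-trivial characters of `t`. By weak continuity in `s` it
is orthogonal to itself. -/
theorem eq_zero_of_unitaryGroup_eq (hvw : symplecticForm v w ≠ 0)
    (h : ∀ t, unitaryGroup v t g = g) : g = 0 := by
  have horth : ∀ s : ℝ, s ≠ 0 → inner ℂ g (unitaryGroup w s g) = 0 := by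
    intro s hs
    have h1 : ∀ t : ℝ, inner ℂ g (unitaryGroup w s g)
        = phase (t * (s * symplecticForm v w)) * inner ℂ g (unitaryGroup w s g) := fun t => by
      conv_lhs => rw [← inner_unitaryGroup_unitaryGroup v t, unitaryGroup_comm, h t,
        inner_smul_right, mul_assoc]
    -- the shift by a half period gives the phase `-1`
    have h2 := h1 ((s * symplecticForm v w)⁻¹ * (1 / 2))
    have h3 : phase ((s * symplecticForm v w)⁻¹ * (1 / 2) * (s * symplecticForm v w)) = -1 := by
      rw [mul_right_comm, inv_mul_cancel₀ (mul_ne_zero hs hvw), phase, ← Complex.exp_pi_mul_I]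
      congr 1
      push_cast
      ring
    rw [h3] at h2
    linear_combination h2 / 2
  by_contra hg
  have hg0 : 0 < ‖g‖ := norm_pos_iff.2 hg
  obtain ⟨φ, hφ⟩ := denseRange_schwartz_toLp.exists_dist_lt g (show 0 < ‖g‖ / 2 by positivity)
  rw [dist_eq_norm] at hφ
  have hcont := (hasDerivAt_inner_toLp_unitaryGroup w φ g).continuousAt.tendsto
  rw [unitaryGroup_zero] at hcont
  have hbound : ∀ s : ℝ, s ≠ 0 →
      ‖inner ℂ (φ.toLp 2 volume) (unitaryGroup w s g)‖ ≤ ‖g - φ.toLp 2 volume‖ * ‖g‖ := fun s hs => by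
    have h1 := norm_inner_le_norm (𝕜 := ℂ) (g - φ.toLp 2 volume) (unitaryGroup w s g)
    rwa [inner_sub_left, horth s hs, zero_sub, norm_neg, norm_unitaryGroup] at h1
  have hlim : ‖inner ℂ (φ.toLp 2 volume) g‖ ≤ ‖g - φ.toLp 2 volume‖ * ‖g‖ :=
    le_of_tendsto ((hcont.mono_left nhdsWithin_le_nhds).norm : Filter.Tendsto _
      (nhdsWithin (0 : ℝ) {0}ᶜ) _) (Filter.eventually_of_mem self_mem_nhdsWithin hbound)
  have h2 := norm_inner_le_norm (𝕜 := ℂ) (g - φ.toLp 2 volume) g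
  have h3 : ‖inner ℂ g g‖ ≤ ‖inner ℂ (g - φ.toLp 2 volume) g‖ + ‖inner ℂ (φ.toLp 2 volume) g‖ := by
    rw [inner_sub_left]
    exact norm_le_norm_sub_add _ _
  have h4 : ‖inner ℂ g g‖ = ‖g‖ * ‖g‖ := by
    rw [inner_self_eq_norm_sq_to_K]; simp [pow_two]
  have h5 := mul_lt_mul_of_pos_right hφ hg0
  linarith

theorem toTemperedDistribution_injective :
    Function.Injective (Lp.toTemperedDistribution : L2 d → 𝓢'(Rd d, ℂ)) :=
  LinearMap.ker_eq_bot.1 (Lp.ker_toTemperedDistributionCLM_eq_bot (E := Rd d) (F := ℂ)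
    (μ := volume) (p := 2))

theorem exists_eq_of_normQ_ne_top (h : normQ v g ≠ ⊤) :
    ∃ u : L2 d, Lp.toTemperedDistribution u = Q v (Lp.toTemperedDistribution g) := by
  by_contra! hne
  exact h (by simp [normQ, distL2Norm, hne])

theorem normQ_eq_enorm (hu : Lp.toTemperedDistribution u = Q v (Lp.toTemperedDistribution g)) :
    normQ v g = ‖u‖ₑ := by
  refine le_antisymm (iInf₂_le u hu) (le_iInf₂ fun u' hu' => ?_)
  rw [toTemperedDistribution_injective (hu.trans hu'.symm)]

/-- If `Q_v g = 0` then `g` is invariant under `e^{2πitQ_v}`, which forces `g = 0` as soon as some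
`Q_w` does not commute with `Q_v`. -/
theorem normQ_ne_zero (hvw : symplecticForm v w ≠ 0) (hg : g ≠ 0) : normQ v g ≠ 0 := by
  intro h0
  obtain ⟨u, hu⟩ := exists_eq_of_normQ_ne_top (h0.trans_ne ENNReal.zero_ne_top)
  rw [normQ_eq_enorm hu, enorm_eq_zero] at h0
  refine hg (eq_zero_of_unitaryGroup_eq hvw fun t => ?_)
  have h1 := norm_unitaryGroup_sub_le hu t
  rw [h0, norm_zero, mul_zero, zero_mul] at h1
  exact sub_eq_zero.1 (norm_le_zero_iff.1 h1)

end BalianLow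

theorem theoremt13 (d : ℕ)
    (Λ : Submodule ℤ (BalianLow.Rd d × BalianLow.Rd d)) [DiscreteTopology Λ] [IsZLattice ℝ Λ]
    (g : BalianLow.L2 d)
    (hg : BalianLow.IsExactFrame (BalianLow.gaborSystem Λ g))
    (v w : BalianLow.Rd d × BalianLow.Rd d)
    (hvw : BalianLow.symplecticForm v w ≠ 0) :
    BalianLow.normQ v g * BalianLow.normQ w g *
      BalianLow.normQ v (BalianLow.canonicalDual Λ g) *
      BalianLow.normQ w (BalianLow.canonicalDual Λ g) = ⊤ := by
  have hwv : BalianLow.symplecticForm w v ≠ 0 := by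
    rwa [BalianLow.symplecticForm_swap v w, neg_ne_zero]
  have h1 := BalianLow.inner_canonicalDual_self hg
  have hg0 : g ≠ 0 := fun h => by simp [h] at h1
  have hγ0 : BalianLow.canonicalDual Λ g ≠ 0 := fun h => by simp [h] at h1
  by_contra hne
  -- `0 * ⊤ = 0` in `ℝ≥0∞`, so a finite product has finite factors only if none of them vanishes
  have n1 := BalianLow.normQ_ne_zero hvw hg0
  have n2 := BalianLow.normQ_ne_zero hwv hg0
  have n3 := BalianLow.normQ_ne_zero hvw hγ0
  have n4 := BalianLow.normQ_ne_zero hwv hγ0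
  have f4 := (ENNReal.lt_top_of_mul_ne_top_right hne (mul_ne_zero (mul_ne_zero n1 n2) n3)).ne
  have f123 := (ENNReal.lt_top_of_mul_ne_top_left hne n4).ne
  have f3 := (ENNReal.lt_top_of_mul_ne_top_right f123 (mul_ne_zero n1 n2)).ne
  have f12 := (ENNReal.lt_top_of_mul_ne_top_left f123 n3).ne
  have f2 := (ENNReal.lt_top_of_mul_ne_top_right f12 n1).ne
  have f1 := (ENNReal.lt_top_of_mul_ne_top_left f12 n2).ne
  obtain ⟨uv, huv⟩ := BalianLow.exists_eq_of_normQ_ne_top f1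
  obtain ⟨uw, huw⟩ := BalianLow.exists_eq_of_normQ_ne_top f2
  obtain ⟨sv, hsv⟩ := BalianLow.exists_eq_of_normQ_ne_top f3
  obtain ⟨sw, hsw⟩ := BalianLow.exists_eq_of_normQ_ne_top f4
  exact hvw (BalianLow.symplecticForm_eq_zero_of_hasWeakDeriv hg
    (BalianLow.hasWeakDeriv_of_eq huv) (BalianLow.hasWeakDeriv_of_eq huw)
    (BalianLow.hasWeakDeriv_of_eq hsv) (BalianLow.hasWeakDeriv_of_eq hsw))
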